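/- Let $V$ be a real vector space of finite dimension $n$, and let $X$ be the symmetric space of $\mathrm{PGL}(V)=\mathrm{GL}(V)/\mathbb{R}^\times$, i.e. the space of inner products on $V$ up to positive scaling, with $\mathrm{PGL}(V)$ acting by $(g\cdot p)(u,v)=p(g^{-1}u,g^{-1}v)$. Let $d_X$ be the distance of the $\mathrm{PGL}(V)$-invariant Riemannian metric on $X$ that is induced by $\tfrac14\left(\operatorname{tr}(H^2)-\tfrac1n(\operatorname{tr}H)^2\right)$, where $H=p^{-1}q$ is the endomorphism with $p(Hu,v)=q(u,v)$ representing a tangent vector $q$ (a symmetric bilinear form) at the inner product $p$. A maximal flat in $X$ is an orbit $A\cdot p$, where $A\subset\mathrm{PGL}(V)$ is a subgroup that is maximal among the connected abelian subgroups all of whose elements are diagonalizable over $\mathbb{R}$, and $p\in X$ is such that some basis of $V$ is orthonormal for an inner product in the class $p$ and diagonalizes every element of $A$. Fix an inner product on $V$, let $o\in X$ be its class, and let $\mu:\mathrm{PGL}(V)\to\mathbb{R}^n$ be the corresponding Cartan projection: $\mu(g)=(\log\sigma_1(\bar g),\dots,\log\sigma_n(\bar g))$, where $\bar g\in\mathrm{GL}(V)$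 represents $g$, $|\det\bar g|=1$, and $\sigma_1(\bar g)\ge\dots\ge\sigma_n(\bar g)$ are the singular values of $\bar g$. Let $\theta_0=\{\alpha_1,\dots,\alpha_{n-1}\}$ be the set of simple roots, $\alpha_k(x)=x_k-x_{k+1}$. Let $\mathcal W$ be a collection of sequences $w=(w_i)_{i=0}^\infty$ in $\mathrm{PGL}(V)$ such that: 1. (rooted) $w_0=\mathrm{id}$ for every $w\in\mathcal W$; 2. (regulated) for every $D>0$ there is an integer $N>0$ such that $\alpha(\mu(w_i^{-1}w_{i+j}))\ge D$ for all $w\in\mathcal W$, all integers $i\ge0$ and $j\ge N$, and all $\alpha\in\theta_0$; 3. (uniformly well-behaved) there is a constant $C>0$ such that for every $w\in\mathcal W$ there is a maximal flat $\mathbf F\subset X$ with $d_X(w_i\cdot o,\mathbf F)\le C$ for all $i\ge0$, and $d_X(w_i\cdot o,w_{i+1}\cdot o)\le C$ for all $i\ge 0$. Then there are constants $\kappa,\kappa'>0$ such that $$\alpha(\mu(w_{i+j}))-\alpha(\mu(w_i))\ \ge\ \kappa j-\kappa'$$ for all $w\in\mathcal W$, all integers $i,j\ge0$ and all $\alpha\in\theta_0$.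 -/

import Mathlib

open Module

noncomputable section

namespace SymmSpace

/-! ### Roots -/

/-- The `(i, j)`-th root `x ↦ x i - x j`. -/
def root {n : ℕ} (i j : Fin n) : (Fin n → ℝ) →ₗ[ℝ] ℝ :=
  (LinearMap.proj i : (Fin n → ℝ) →ₗ[ℝ] ℝ) - LinearMap.proj j

/-- The set of simple roots `x ↦ x k - x (k + 1)`. -/
def simpleRoots (n : ℕ) : Set ((Fin n → ℝ) →ₗ[ℝ] ℝ) :=
  {α | ∃ (k : ℕ) (hk : k + 1 < n), α = root ⟨k, by omega⟩ ⟨k + 1, hk⟩}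

/-! ### The groups `GL(V)` and `PGL(V)` -/

section Groups

variable (V : Type*) [NormedAddCommGroup V] [InnerProductSpace ℝ V]

/-- `GL(V)`, with its usual topology. In finite dimension every linear map is continuous. -/
abbrev GLin : Type _ := (V →L[ℝ] V)ˣ

/-- The inclusion of the non-zero scalars in `GL(V)`. -/
def scalarHom : ℝˣ →* GLin V :=
  Units.map (algebraMap ℝ (V →L[ℝ] V)).toMonoidHom

/-- The subgroup of non-zero scalars in `GL(V)`. -/
abbrev scalars : Subgroup (GLin V) := (scalarHom V).range

variable {V}

@[simp] theorem scalarHom_apply (c : ℝˣ) (v : V) :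
    (scalarHom V c : V →L[ℝ] V) v = (c : ℝ) • v := by
  simp [scalarHom, Algebra.algebraMap_eq_smul_one]

theorem scalarHom_comm (c : ℝˣ) (g : GLin V) : g * scalarHom V c = scalarHom V c * g := by
  ext v
  simp

instance scalars_normal : (scalars V).Normal := by
  refine ⟨?_⟩
  rintro _ ⟨c, rfl⟩ g
  exact ⟨c, by rw [scalarHom_comm, mul_inv_cancel_right]⟩

variable (V) in
/-- `PGL(V)`, the quotient of `GL(V)` by the non-zero scalars, with the quotient topology. -/
abbrev PGLin : Type _ := GLin V ⧸ scalars V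

theorem GLin.inv_apply_apply (g : GLin V) (v : V) :
    ((g⁻¹ : GLin V) : V →L[ℝ] V) ((g : V →L[ℝ] V) v) = v := by
  have h : ((g⁻¹ * g : GLin V) : V →L[ℝ] V) v = v := by simp
  simpa only [Units.val_mul, mul_apply_eq_comp] using h

theorem GLin.apply_inv_apply (g : GLin V) (v : V) :
    (g : V →L[ℝ] V) (((g⁻¹ : GLin V) : V →L[ℝ] V) v) = v := by
  have h : ((g * g⁻¹ : GLin V) : V →L[ℝ] V) v = v := by simp
  simpa only [Units.val_mul, mul_apply_eq_comp] using h

end Groups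

/-! ### The symmetric space -/

section Space

variable (V : Type*) [NormedAddCommGroup V] [InnerProductSpace ℝ V]

/-- An inner product on the vector space `V` (in general not the one that `V` carries). -/
@[ext] structure InnerForm where
  form : LinearMap.BilinForm ℝ V
  symm : ∀ u v, form u v = form v u
  pos : ∀ v, v ≠ 0 → 0 < form v v

variable {V}

theorem InnerForm.nondegenerate (p : InnerForm V) : p.form.Nondegenerate := by
  refine ⟨fun v hv => ?_, fun v hv => ?_⟩
  · by_contra h
    exact (p.pos v h).ne' (hv v)
  · by_contra h
    exact (p.pos v h).ne' (hv v)

/-- `GL(V)` acts on inner products by `(g • p)(u, v) = p (g⁻¹ u) (g⁻¹ v)`. -/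
instance : MulAction (GLin V) (InnerForm V) where
  smul g p :=
    { form := p.form.comp ((g⁻¹ : GLin V) : V →L[ℝ] V).toLinearMap
        ((g⁻¹ : GLin V) : V →L[ℝ] V).toLinearMap
      symm := fun u v => p.symm _ _
      pos := fun v hv => p.pos _ fun h => hv (by
        have := GLin.apply_inv_apply g v
        rw [← this]
        change ((g⁻¹ : GLin V) : V →L[ℝ] V) v = 0 at h
        rw [h, map_zero]) }
  one_smul p := by
    ext u v
    change p.form (((1 : GLin V)⁻¹ : GLin V).val u) (((1 : GLin V)⁻¹ : GLin V).val v) = p.form u v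
    simp
  mul_smul g h p := by
    ext u v
    change p.form (((g * h)⁻¹ : GLin V).val u) (((g * h)⁻¹ : GLin V).val v) =
      p.form ((h⁻¹ : GLin V).val ((g⁻¹ : GLin V).val u))
        ((h⁻¹ : GLin V).val ((g⁻¹ : GLin V).val v))
    simp [mul_inv_rev]

theorem InnerForm.smul_form (g : GLin V) (p : InnerForm V) (u v : V) :
    (g • p).form u v =
      p.form (((g⁻¹ : GLin V) : V →L[ℝ] V) u) (((g⁻¹ : GLin V) : V →L[ℝ] V) v) := rfl

variable (V) in
/-- Two inner products are equivalent when they are (positive) multiples of each other. -/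
def scaleSetoid : Setoid (InnerForm V) where
  r p q := ∃ c : ℝ, 0 < c ∧ q.form = c • p.form
  iseqv :=
    { refl := fun p => ⟨1, one_pos, by simp⟩
      symm := by
        rintro p q ⟨c, hc, h⟩
        exact ⟨c⁻¹, inv_pos.2 hc, by rw [h, smul_smul, inv_mul_cancel₀ hc.ne', one_smul]⟩
      trans := by
        rintro p q r ⟨c, hc, h⟩ ⟨d, hd, h'⟩
        exact ⟨d * c, mul_pos hd hc, by rw [h', h, smul_smul]⟩ }

variable (V) in
/-- The symmetric space `X` of `PGL(V)`: inner products on `V` up to scaling. -/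
def XSpace : Type _ := Quotient (scaleSetoid V)

/-- The point of `X` given by an inner product. -/
def XSpace.mk (p : InnerForm V) : XSpace V := Quotient.mk (scaleSetoid V) p

instance : MulAction (GLin V) (XSpace V) where
  smul g := Quotient.map (fun p => g • p) (by
    rintro p q ⟨c, hc, h⟩
    refine ⟨c, hc, ?_⟩
    ext u v
    simp [InnerForm.smul_form, h])
  one_smul x := by
    induction x using Quotient.inductionOn with
    | h p => exact congrArg (XSpace.mk (V := V)) (one_smul (GLin V) p)
  mul_smul g h x := by
    induction x using Quotient.inductionOn with
    | h p => exact congrArg (XSpace.mk (V := V)) (mul_smul g h p)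

theorem XSpace.smul_mk (g : GLin V) (p : InnerForm V) :
    g • XSpace.mk p = XSpace.mk (g • p) := rfl

theorem XSpace.scalar_smul (c : ℝˣ) (x : XSpace V) : scalarHom V c • x = x := by
  induction x using Quotient.inductionOn with
  | h p =>
    refine Quotient.sound (s := scaleSetoid V) ⟨(c : ℝ) * c, mul_self_pos.2 c.ne_zero, ?_⟩
    ext u v
    change p.form u v = ((c : ℝ) * c) •
      p.form ((scalarHom V c)⁻¹.val u) ((scalarHom V c)⁻¹.val v)
    rw [← map_inv]
    simp only [scalarHom_apply, map_smul, LinearMap.smul_apply, smul_eq_mul, Units.val_inv_eq_inv_val]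
    field_simp [c.ne_zero]

/-- The action of `PGL(V)` on `X`, induced by that of `GL(V)` on inner products. -/
instance : MulAction (PGLin V) (XSpace V) where
  smul a x := Quotient.liftOn' a (fun g : GLin V => g • x) (by
    intro g h hgh
    obtain ⟨c, hc⟩ := QuotientGroup.leftRel_apply.1 hgh
    have h1 : h = g * scalarHom V c := by rw [hc, mul_inv_cancel_left]
    change g • x = h • x
    rw [h1, mul_smul, XSpace.scalar_smul])
  one_smul x := one_smul (GLin V) x
  mul_smul a b x := by
    induction a using QuotientGroup.induction_on with
    | H g =>
      induction b using QuotientGroup.induction_on with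
      | H h => exact mul_smul g h x

theorem XSpace.coe_smul (g : GLin V) (x : XSpace V) : (g : PGLin V) • x = g • x := rfl

variable (V) in
/-- The base point `o` of `X`: the class of the inner product that `V` carries. -/
def basePoint : XSpace V :=
  XSpace.mk
    { form := innerₗ V
      symm := fun u v => by simp [real_inner_comm]
      pos := fun v hv => by simpa using real_inner_self_pos.2 hv }

end Space

section Metric

variable {V : Type*} [NormedAddCommGroup V] [InnerProductSpace ℝ V] [FiniteDimensional ℝ V]

/-- The endomorphism `p⁻¹ q` that represents the bilinear form `q` through the inner product `p`,
that is `p (relEnd p q u) v = q u v`. -/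
def InnerForm.relEnd (p : InnerForm V) (q : LinearMap.BilinForm ℝ V) : V →ₗ[ℝ] V :=
  q.symmCompOfNondegenerate p.form p.nondegenerate

/-- The Riemannian norm on `X` of the image of a tangent vector `q` (a symmetric bilinear form)
at the inner product `p`. The kernel of the projection to the tangent space of `X` consists of the
multiples of `p`, so it is half the Frobenius norm of the trace-free part of `H = p⁻¹ q`, namely
`(1 / 2) * √(tr (H²) - (tr H)² / n)`. With this normalization the parametrizations
`x ↦ diag (e ^ x) • p` of flats by sum-zero vectors are isometric for the standard norm. -/
def InnerForm.speed (p : InnerForm V) (q : LinearMap.BilinForm ℝ V) : ℝ :=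
  (1 / 2) * √(LinearMap.trace ℝ V (p.relEnd q ∘ₗ p.relEnd q)
    - (LinearMap.trace ℝ V (p.relEnd q)) ^ 2 / (finrank ℝ V : ℝ))

/-- A `C¹` path of inner products, with velocity `vel`, on the time interval `[0, 1]`. -/
structure InnerPath (V : Type*) [NormedAddCommGroup V] [InnerProductSpace ℝ V] where
  pt : ℝ → InnerForm V
  vel : ℝ → LinearMap.BilinForm ℝ V
  hasDeriv : ∀ t ∈ Set.Icc (0 : ℝ) 1, ∀ u v : V,
    HasDerivWithinAt (fun s => (pt s).form u v) (vel t u v) (Set.Icc 0 1) t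
  velCont : ∀ u v : V, ContinuousOn (fun t => vel t u v) (Set.Icc 0 1)

/-- The Riemannian length of the path in `X` covered by a path of inner products. -/
def InnerPath.length (γ : InnerPath V) : ℝ :=
  ∫ t in (0 : ℝ)..1, (γ.pt t).speed (γ.vel t)

/-- The Riemannian distance on `X`: the infimum of the lengths of paths joining two points. -/
def dX (x y : XSpace V) : ℝ :=
  sInf {L | ∃ γ : InnerPath V,
    XSpace.mk (γ.pt 0) = x ∧ XSpace.mk (γ.pt 1) = y ∧ L = γ.length}

/-- The distance from a point of `X` to a subset of `X`. -/
def dXSet (x : XSpace V) (F : Set (XSpace V)) : ℝ :=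
  sInf (dX x '' F)

end Metric

/-! ### Maximal flats -/

section Flats

variable {V : Type*} [NormedAddCommGroup V] [InnerProductSpace ℝ V]

/-- The class of `g` is represented by a diagonal matrix in the basis `b`. -/
def IsDiagonalIn (b : Basis (Fin (finrank ℝ V)) ℝ V) (a : PGLin V) : Prop :=
  ∃ g : GLin V, (g : PGLin V) = a ∧ ∀ i, ∃ c : ℝ, (g : V →L[ℝ] V) (b i) = c • b i

/-- A diagonalizable (element by element), connected, abelian subgroup of `PGL(V)`. -/
structure IsSplitConnAbelian (A : Subgroup (PGLin V)) : Prop where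
  diagonalizable : ∀ a ∈ A, ∃ b : Basis (Fin (finrank ℝ V)) ℝ V, IsDiagonalIn b a
  connected : IsConnected (A : Set (PGLin V))
  abelian : ∀ a ∈ A, ∀ a' ∈ A, a * a' = a' * a

/-- `b` is an appropriate basis for `(A, p)`: every element of `A` is diagonal in `b`, and `b` is
orthonormal for some inner product in the class `p`. -/
def IsAppropriateBasis (b : Basis (Fin (finrank ℝ V)) ℝ V) (A : Subgroup (PGLin V))
    (p : XSpace V) : Prop :=
  (∀ a ∈ A, IsDiagonalIn b a) ∧
    ∃ q : InnerForm V, XSpace.mk q = p ∧ ∀ i j, q.form (b i) (b j) = if i = j then 1 else 0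

/-- The maximal flats of `X`: the orbits `A • p`, for a maximal diagonalizable connected abelian
subgroup `A` of `PGL(V)` and a point `p` such that `(A, p)` has an appropriate basis. -/
def IsMaximalFlat (F : Set (XSpace V)) : Prop :=
  ∃ (A : Subgroup (PGLin V)) (p : XSpace V), Maximal IsSplitConnAbelian A ∧
    (∃ b, IsAppropriateBasis b A p) ∧ F = MulAction.orbit A p

end Flats

/-! ### The Cartan projection -/

section Cartan

variable {V : Type*} [NormedAddCommGroup V] [InnerProductSpace ℝ V] [FiniteDimensional ℝ V]

/-- The Cartan projection of `GL(V)`: logarithms of the singular values, in decreasing order. -/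
def cartanGL (g : GLin V) : Fin (finrank ℝ V) → ℝ :=
  fun i => Real.log ((g : V →L[ℝ] V).toLinearMap.singularValues i)

theorem exists_unimodular_rep (a : PGLin V) :
    ∃ g : GLin V, (g : PGLin V) = a ∧ |LinearMap.det (g : V →L[ℝ] V).toLinearMap| = 1 := by
  induction a using QuotientGroup.induction_on with
  | H g =>
    set d := LinearMap.det (g : V →L[ℝ] V).toLinearMap with hd
    have hd0 : d ≠ 0 := by
      have h1 : LinearMap.det ((g⁻¹ : GLin V) : V →L[ℝ] V).toLinearMap * d = 1 := by
        rw [hd, ← LinearMap.det_comp]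
        have : ((g⁻¹ : GLin V) : V →L[ℝ] V).toLinearMap ∘ₗ (g : V →L[ℝ] V).toLinearMap
            = LinearMap.id := LinearMap.ext fun v => GLin.inv_apply_apply g v
        rw [this, LinearMap.det_id]
      exact right_ne_zero_of_mul_eq_one h1
    have hpos : 0 < |d| := abs_pos.2 hd0
    rcases Nat.eq_zero_or_pos (finrank ℝ V) with hn | hn
    · refine ⟨g, rfl, ?_⟩
      rw [LinearMap.det_eq_one_of_finrank_eq_zero hn, abs_one]
    · set c : ℝ := |d| ^ (-(1 / (finrank ℝ V : ℝ))) with hc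
      have hcpos : 0 < c := Real.rpow_pos_of_pos hpos _
      refine ⟨g * scalarHom V (Units.mk0 c hcpos.ne'), ?_, ?_⟩
      · exact QuotientGroup.mk_mul_of_mem _ ⟨_, rfl⟩
      · have h2 : ((g * scalarHom V (Units.mk0 c hcpos.ne') : GLin V) : V →L[ℝ] V).toLinearMap
            = c • (g : V →L[ℝ] V).toLinearMap := LinearMap.ext fun v => by simp
        rw [h2, LinearMap.det_smul, abs_mul, abs_pow, abs_of_pos hcpos, hc,
          ← Real.rpow_mul_natCast hpos.le]
        have hn' : (finrank ℝ V : ℝ) ≠ 0 := by positivity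
        rw [neg_mul, one_div_mul_cancel hn', Real.rpow_neg_one]
        exact inv_mul_cancel₀ hpos.ne'

/-- The Cartan projection of `PGL(V)` with respect to the base point `o`: the Cartan projection of
a linear representative `g` with `|det g| = 1`. -/
def cartan (a : PGLin V) : Fin (finrank ℝ V) → ℝ :=
  cartanGL (exists_unimodular_rep a).choose

/-- The Cartan projection does not depend on the representative with `|det g| = 1`. -/
theorem cartan_mk (g : GLin V) (hg : |LinearMap.det (g : V →L[ℝ] V).toLinearMap| = 1) :
    cartan (g : PGLin V) = cartanGL g := by
  obtain ⟨h1, h2⟩ := (exists_unimodular_rep (g : PGLin V)).choose_spec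
  unfold cartan
  set h := (exists_unimodular_rep (g : PGLin V)).choose
  obtain ⟨c, hc⟩ := QuotientGroup.eq.1 h1
  have hgh : (g : V →L[ℝ] V).toLinearMap = (c : ℝ) • (h : V →L[ℝ] V).toLinearMap := by
    have : g = h * scalarHom V c := by rw [hc, mul_inv_cancel_left]
    rw [this]
    exact LinearMap.ext fun v => by simp
  funext i
  have hn : finrank ℝ V ≠ 0 := fun h0 => (Fin.cast h0 i).elim0
  have hc1 : (c : ℝ) * c = 1 := by
    rw [hgh, LinearMap.det_smul, abs_mul, h2, mul_one, abs_pow] at hg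
    have := (pow_eq_one_iff_of_nonneg (abs_nonneg _) hn).1 hg
    rw [← abs_mul_abs_self, this, one_mul]
  have hadj : LinearMap.adjoint (g : V →L[ℝ] V).toLinearMap ∘ₗ (g : V →L[ℝ] V).toLinearMap
      = LinearMap.adjoint (h : V →L[ℝ] V).toLinearMap ∘ₗ (h : V →L[ℝ] V).toLinearMap := by
    rw [hgh]
    simp [LinearMap.smul_comp, LinearMap.comp_smul, smul_smul, hc1]
  unfold cartanGL
  rw [LinearMap.singularValues_fin _ rfl, LinearMap.singularValues_fin _ rfl]
  congr 3
  exact hadj.symm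

end Cartan

/-! ### Collections of sequences -/

section Sequences

variable {V : Type*} [NormedAddCommGroup V] [InnerProductSpace ℝ V] [FiniteDimensional ℝ V]

/-- A sequence in `PGL(V)` is rooted if it starts at the identity. -/
def IsRooted (w : ℕ → PGLin V) : Prop := w 0 = 1

/-- There is a uniform `C > 0` such that the orbit of the base point along every sequence stays
within `C` of some maximal flat and moves by at most `C` at each step. -/
def UniformlyWellBehaved (W : Set (ℕ → PGLin V)) : Prop :=
  ∃ C : ℝ, 0 < C ∧ ∀ w ∈ W,
    (∃ F : Set (XSpace V), IsMaximalFlat F ∧ ∀ i, dXSet (w i • basePoint V) F ≤ C) ∧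
    ∀ i, dX (w i • basePoint V) (w (i + 1) • basePoint V) ≤ C

/-- For every `D > 0` there is `N > 0` with `α (μ (w i ⁻¹ * w (i + j))) ≥ D` for all sequences
`w`, all `i`, all `j ≥ N` and all simple roots `α`. -/
def Regulated (W : Set (ℕ → PGLin V)) : Prop :=
  ∀ D : ℝ, 0 < D → ∃ N : ℕ, 0 < N ∧ ∀ w ∈ W, ∀ i j : ℕ, N ≤ j →
    ∀ α ∈ simpleRoots (finrank ℝ V), D ≤ α (cartan ((w i)⁻¹ * w (i + j)))

end Sequences

end SymmSpace

end

/-! Distances in `X` enter only through `Comparable`: along a path, the logarithm of a ratio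
`q(v,v)/q(u,u)` changes at rate at most four times the speed, so points at distance less than `C +
1` are comparable with constant `exp L`, `L = 4 * (C + 1)`. Replace each orbit point by a nearby
point of the flat, with diagonal coordinates `y m` in one basis. By a min-max argument, the Cartan
gaps of `(g i)⁻¹ * g m` agree up to `2 * L` with those of the sorted vector `y m - y i`
(`abs_cartanGL_gap_sub_le`). Regulation with `D = 6 * L` then keeps every root of `y (i + j) - y i`
at absolute value at least `4 * L` once `j ≥ N`, while one step changes a root by at most `3 / 2 *
L`. Such a root cannot change sign (`le_sub_of_le_abs_sub`), so a single permutation sorts all these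
increments: the path stays in one Weyl chamber direction. Each simple root in the sorted order
therefore gains `4 * L` every `N` steps (`linear_growth`), and it equals the corresponding Cartan
gap up to a bounded error. -/

noncomputable section

namespace SymmSpace

/-! ### Comparability of inner products and the Riemannian distance -/

section Comparison

variable {V : Type*} [NormedAddCommGroup V] [InnerProductSpace ℝ V]

/-- The ratio of the quadratic forms of `q` and `p` varies by a factor of at most `K`. This only
depends on the classes of `p` and `q` up to scaling. -/
def Comparable (K : ℝ) (p q : InnerForm V) : Prop :=
  ∀ u v, q.form v v * p.form u u ≤ K * (p.form v v * q.form u u)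

theorem InnerForm.nonneg (p : InnerForm V) (v : V) : 0 ≤ p.form v v := by
  rcases eq_or_ne v 0 with rfl | h
  · simp
  · exact (p.pos v h).le

theorem Comparable.symm {K : ℝ} {p q : InnerForm V} (h : Comparable K p q) :
    Comparable K q p := fun u v => by
  have := h v u
  linarith

theorem Comparable.trans {K L : ℝ} {p q r : InnerForm V} (hK : 0 ≤ K) (h : Comparable K p q)
    (h' : Comparable L q r) : Comparable (K * L) p r := fun u v => by
  rcases eq_or_ne u 0 with rfl | hu
  · simp
  rcases eq_or_ne v 0 with rfl | hv
  · simp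
  have h1 := h u v
  have h2 := h' u v
  have hq := mul_pos (q.pos u hu) (q.pos v hv)
  refine le_of_mul_le_mul_right ?_ hq
  calc r.form v v * p.form u u * (q.form u u * q.form v v)
      = (q.form v v * p.form u u) * (r.form v v * q.form u u) := by ring
    _ ≤ (K * (p.form v v * q.form u u)) * (L * (q.form v v * r.form u u)) :=
        mul_le_mul h1 h2 (mul_nonneg (r.nonneg _) (q.nonneg _))
          (mul_nonneg hK (mul_nonneg (p.nonneg _) (q.nonneg _)))
    _ = _ := by ring

theorem Comparable.congr_left {K : ℝ} {p p' q : InnerForm V} (hp : XSpace.mk p = XSpace.mk p')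
    (h : Comparable K p q) : Comparable K p' q := fun u v => by
  obtain ⟨c, hc, hform⟩ := Quotient.exact hp
  have h1 := mul_le_mul_of_nonneg_left (h u v) hc.le
  simp only [hform, LinearMap.smul_apply, smul_eq_mul]
  linarith

theorem Comparable.congr {K : ℝ} {p p' q q' : InnerForm V} (hp : XSpace.mk p = XSpace.mk p')
    (hq : XSpace.mk q = XSpace.mk q') (h : Comparable K p q) : Comparable K p' q' :=
  ((h.congr_left hp).symm.congr_left hq).symm

theorem InnerForm.exists_orthonormal_basis [FiniteDimensional ℝ V] (p : InnerForm V) :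
    ∃ b : Basis (Fin (finrank ℝ V)) ℝ V, ∀ i j, p.form (b i) (b j) = if i = j then 1 else 0 := by
  obtain ⟨v, hv⟩ := LinearMap.BilinForm.exists_orthogonal_basis (B := p.form) ⟨p.symm⟩
  have hpos : ∀ i, 0 < √(p.form (v i) (v i)) := fun i => Real.sqrt_pos.2 (p.pos _ (v.ne_zero i))
  refine ⟨v.unitsSMul fun i => (Units.mk0 _ (hpos i).ne')⁻¹, fun i j => ?_⟩
  simp only [Basis.unitsSMul_apply, Units.smul_def, Units.val_inv_eq_inv_val, Units.val_mk0,
    map_smul, LinearMap.smul_apply, smul_eq_mul]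
  split_ifs with h
  · subst h
    have h1 := Real.mul_self_sqrt (p.nonneg (v i))
    have h2 := (hpos i).ne'
    field_simp
    rw [sq, h1]
  · have : p.form (v i) (v j) = 0 := hv h
    rw [this]
    simp

theorem form_apply_eq_sum {ι : Type*} [Fintype ι] (q : LinearMap.BilinForm ℝ V)
    (b : Basis ι ℝ V) (u v : V) :
    q u v = ∑ i, ∑ j, b.repr u i * b.repr v j * q (b i) (b j) := by
  conv_lhs => rw [← b.sum_repr u, ← b.sum_repr v]
  simp only [map_sum, LinearMap.sum_apply, map_smul, LinearMap.smul_apply, smul_eq_mul,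
    Finset.mul_sum]
  rw [Finset.sum_comm]
  exact Finset.sum_congr rfl fun i _ => Finset.sum_congr rfl fun j _ => by ring

theorem form_self_eq_sum_of_diagonal {ι : Type*} [Fintype ι] [DecidableEq ι]
    {q : LinearMap.BilinForm ℝ V} {b : Basis ι ℝ V} {d : ι → ℝ}
    (h : ∀ i j, q (b i) (b j) = if i = j then d i else 0) (v : V) :
    q v v = ∑ i, d i * b.repr v i ^ 2 := by
  rw [form_apply_eq_sum q b]
  refine Finset.sum_congr rfl fun i _ => ?_
  simp only [h, mul_ite, mul_zero, Finset.sum_ite_eq, Finset.mem_univ, if_true]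
  ring

theorem Comparable.mono {K L : ℝ} {p q : InnerForm V} (hKL : K ≤ L) (h : Comparable K p q) :
    Comparable L p q := fun u v =>
  (h u v).trans (mul_le_mul_of_nonneg_right hKL (mul_nonneg (p.nonneg _) (q.nonneg _)))

theorem InnerPath.vel_symm (γ : InnerPath V) {t : ℝ} (ht : t ∈ Set.Icc (0 : ℝ) 1) (u v : V) :
    γ.vel t u v = γ.vel t v u := by
  have h1 := γ.hasDeriv t ht u v
  have h2 := γ.hasDeriv t ht v u
  have h3 : (fun s => (γ.pt s).form u v) = fun s => (γ.pt s).form v u :=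
    funext fun s => (γ.pt s).symm u v
  rw [h3] at h1
  exact (uniqueDiffOn_Icc_zero_one t ht).eq_deriv _ h1 h2

/-- Any two inner products are joined by a path. -/
theorem exists_innerPath (p q : InnerForm V) : ∃ γ : InnerPath V, γ.pt 0 = p ∧ γ.pt 1 = q := by
  -- `pt` must be positive definite at every real time, so the affine segment is frozen outside `[0,
  -- 1]`.
  let c : ℝ → ℝ := fun t => Set.projIcc (0 : ℝ) 1 zero_le_one t
  have hc : ∀ t, 0 ≤ c t ∧ c t ≤ 1 := fun t => (Set.projIcc (0 : ℝ) 1 zero_le_one t).2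
  have hct : ∀ t ∈ Set.Icc (0 : ℝ) 1, c t = t := fun t ht => by
    simp only [c, Set.projIcc_of_mem _ ht]
  let pt : ℝ → InnerForm V := fun t =>
    { form := p.form + c t • (q.form - p.form)
      symm := fun u v => by simp [p.symm u v, q.symm u v]
      pos := fun v hv => by
        simp only [LinearMap.add_apply, LinearMap.smul_apply, LinearMap.sub_apply, smul_eq_mul]
        have h1 := p.pos v hv
        have h2 := q.pos v hv
        obtain ⟨h3, h4⟩ := hc t
        rcases h4.lt_or_eq with h5 | h5
        · nlinarith [mul_nonneg h3 h2.le, mul_pos (sub_pos.2 h5) h1]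
        · rw [h5]
          linarith }
  refine ⟨⟨pt, fun _ => q.form - p.form, fun t ht u v => ?_, fun u v => continuousOn_const⟩, ?_, ?_⟩
  · have h : HasDerivWithinAt (fun s : ℝ => p.form u v + s * (q.form u v - p.form u v))
        (q.form u v - p.form u v) (Set.Icc 0 1) t := by
      simpa using! ((hasDerivWithinAt_id t (Set.Icc (0 : ℝ) 1)).mul_const
        (q.form u v - p.form u v)).const_add (p.form u v)
    exact h.congr (fun s hs => by simp [pt, hct s hs]) (by simp [pt, hct t ht])
  · ext u v
    simp [pt, hct 0 (by simp)]
  · ext u v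
    simp [pt, hct 1 (by simp)]

variable [FiniteDimensional ℝ V]

theorem InnerForm.form_relEnd (p : InnerForm V) (q : LinearMap.BilinForm ℝ V) (u v : V) :
    p.form (p.relEnd q u) v = q u v :=
  LinearMap.BilinForm.symmCompOfNondegenerate_left_apply _ _ _ _

theorem InnerForm.toMatrix_relEnd {ι : Type*} [Fintype ι] [DecidableEq ι] (p : InnerForm V)
    (q : LinearMap.BilinForm ℝ V) (b : Basis ι ℝ V) :
    (LinearMap.toMatrix b b (p.relEnd q)).transpose * LinearMap.BilinForm.toMatrix b p.form =
      LinearMap.BilinForm.toMatrix b q := by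
  ext i j
  rw [LinearMap.BilinForm.toMatrix_apply, ← p.form_relEnd q, Matrix.mul_apply]
  have h : p.form (∑ k, b.repr (p.relEnd q (b i)) k • b k) (b j) =
      ∑ k, b.repr (p.relEnd q (b i)) k * p.form (b k) (b j) := by
    simp only [map_sum, LinearMap.sum_apply, map_smul, LinearMap.smul_apply, smul_eq_mul]
  rw [b.sum_repr] at h
  simp [h, LinearMap.toMatrix_apply, LinearMap.BilinForm.toMatrix_apply]

/-- The speed of a tangent vector bounds the deviation of its Rayleigh quotients from the mean
of the eigenvalues. -/
theorem InnerForm.abs_sub_trace_le_speed (p : InnerForm V) {q : LinearMap.BilinForm ℝ V}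
    (hq : ∀ u v, q u v = q v u) {v : V} (hv : v ≠ 0) :
    |q v v / p.form v v - LinearMap.trace ℝ V (p.relEnd q) / finrank ℝ V| ≤ 2 * p.speed q := by
  obtain ⟨b, hb⟩ := p.exists_orthonormal_basis
  have hn : (finrank ℝ V : ℝ) ≠ 0 := by
    have : Nontrivial V := ⟨v, 0, hv⟩
    exact_mod_cast (finrank_pos (R := ℝ) (M := V)).ne'
  set M : Matrix _ _ ℝ := LinearMap.BilinForm.toMatrix b q with hM
  have hP : LinearMap.BilinForm.toMatrix b p.form = 1 := by
    ext i j
    rw [LinearMap.BilinForm.toMatrix_apply, hb, Matrix.one_apply]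
  have hH : LinearMap.toMatrix b b (p.relEnd q) = M.transpose := by
    rw [hM, ← p.toMatrix_relEnd q b, hP, mul_one, Matrix.transpose_transpose]
  have hMsymm : ∀ i j, M i j = M j i := fun i j => by
    simp only [hM, LinearMap.BilinForm.toMatrix_apply, hq (b i) (b j)]
  have htr : LinearMap.trace ℝ V (p.relEnd q) = ∑ i, M i i := by
    rw [LinearMap.trace_eq_matrix_trace ℝ b, hH]
    rfl
  have htr2 : LinearMap.trace ℝ V (p.relEnd q ∘ₗ p.relEnd q) = ∑ i, ∑ j, M i j ^ 2 := by
    rw [LinearMap.trace_eq_matrix_trace ℝ b, LinearMap.toMatrix_comp b b b, hH]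
    simp only [Matrix.trace, Matrix.diag, Matrix.mul_apply, Matrix.transpose_apply]
    exact Finset.sum_congr rfl fun i _ => Finset.sum_congr rfl fun j _ => by rw [hMsymm j i, sq]
  set t := LinearMap.trace ℝ V (p.relEnd q) / finrank ℝ V with ht
  have htn : ∑ i, M i i = t * finrank ℝ V := by rw [← htr, ht, div_mul_cancel₀ _ hn]
  -- `N` is the trace-free part of `M`; its Frobenius norm is twice the speed.
  set N : Fin (finrank ℝ V) × Fin (finrank ℝ V) → ℝ :=
    fun x => M x.1 x.2 - t * (if x.1 = x.2 then 1 else 0) with hN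
  have hN2 : ∑ x, N x ^ 2 = (∑ i, ∑ j, M i j ^ 2) - (∑ i, M i i) ^ 2 / finrank ℝ V := by
    have h1 : ∑ x, N x ^ 2 = (∑ i, ∑ j, M i j ^ 2) - 2 * t * (∑ i, M i i)
        + t ^ 2 * finrank ℝ V := by
      rw [Fintype.sum_prod_type, Finset.mul_sum]
      have h2 : t ^ 2 * (finrank ℝ V : ℝ) = ∑ _i : Fin (finrank ℝ V), t ^ 2 := by
        simp [mul_comm]
      rw [h2, ← Finset.sum_sub_distrib, ← Finset.sum_add_distrib]
      refine Finset.sum_congr rfl fun i _ => ?_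
      have h3 : ∀ j, N (i, j) ^ 2 =
          M i j ^ 2 + (if i = j then (t ^ 2 - 2 * t * M i j) else 0) := fun j => by
        simp only [hN]
        split_ifs <;> ring
      simp only [h3, Finset.sum_add_distrib, Finset.sum_ite_eq, Finset.mem_univ, if_true]
      ring
    rw [h1, htn]
    field_simp
    ring
  have hspeed : 2 * p.speed q = √(∑ x, N x ^ 2) := by
    rw [InnerForm.speed, htr, htr2, hN2]
    ring
  have hpv : p.form v v = ∑ i, b.repr v i ^ 2 := by
    rw [form_self_eq_sum_of_diagonal (d := fun _ => 1) hb]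
    simp
  have hpos := p.pos v hv
  have hqv : q v v - t * p.form v v = ∑ x, (b.repr v x.1 * b.repr v x.2) * N x := by
    rw [Fintype.sum_prod_type, form_apply_eq_sum q b, hpv, Finset.mul_sum,
      ← Finset.sum_sub_distrib]
    refine Finset.sum_congr rfl fun i _ => ?_
    have h3 : ∀ j, b.repr v i * b.repr v j * N (i, j) =
        b.repr v i * b.repr v j * q (b i) (b j)
          - (if i = j then t * (b.repr v i * b.repr v j) else 0) := fun j => by
      simp only [hN, hM, LinearMap.BilinForm.toMatrix_apply]
      split_ifs <;> ring
    simp only [h3, Finset.sum_sub_distrib, Finset.sum_ite_eq, Finset.mem_univ, if_true]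
    ring
  -- Cauchy–Schwarz between `N` and the rank-one matrix of `v`, whose Frobenius norm is `p.form v
  -- v`.
  have hcs := Finset.sum_mul_sq_le_sq_mul_sq Finset.univ
    (fun x : Fin (finrank ℝ V) × Fin (finrank ℝ V) => b.repr v x.1 * b.repr v x.2) N
  have hc2 : ∑ x : Fin (finrank ℝ V) × Fin (finrank ℝ V), (b.repr v x.1 * b.repr v x.2) ^ 2
      = p.form v v ^ 2 := by
    rw [Fintype.sum_prod_type, hpv, sq (∑ i, _), Finset.sum_mul_sum]
    exact Finset.sum_congr rfl fun i _ => Finset.sum_congr rfl fun j _ => by ring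
  rw [← hqv, hc2] at hcs
  rw [hspeed]
  refine Real.abs_le_sqrt ?_
  have : q v v / p.form v v - t = (q v v - t * p.form v v) / p.form v v := by field_simp
  rw [this, div_pow, div_le_iff₀ (by positivity)]
  linarith

/-- Supplies the integrability needed to bound the change of log-ratios by the length. In a basis,
`relEnd` is the transpose of `Q * P⁻¹`, which depends continuously on time. -/
theorem InnerPath.continuousOn_speed (γ : InnerPath V) :
    ContinuousOn (fun t => (γ.pt t).speed (γ.vel t)) (Set.Icc 0 1) := by
  let b := finBasis ℝ V
  have hH : ∀ t, LinearMap.toMatrix b b ((γ.pt t).relEnd (γ.vel t)) =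
      (LinearMap.BilinForm.toMatrix b (γ.vel t) *
        (LinearMap.BilinForm.toMatrix b (γ.pt t).form)⁻¹).transpose := fun t => by
    have hdet := (LinearMap.BilinForm.nondegenerate_iff_det_ne_zero b).1 (γ.pt t).nondegenerate
    rw [← (γ.pt t).toMatrix_relEnd (γ.vel t) b, Matrix.mul_assoc,
      Matrix.mul_nonsing_inv _ (isUnit_iff_ne_zero.2 hdet), mul_one, Matrix.transpose_transpose]
  have hPc : ContinuousOn (fun t => LinearMap.BilinForm.toMatrix b (γ.pt t).form)
      (Set.Icc 0 1) := by
    refine continuousOn_pi.2 fun i => continuousOn_pi.2 fun j => ?_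
    simp only [LinearMap.BilinForm.toMatrix_apply]
    exact fun t ht => (γ.hasDeriv t ht _ _).continuousWithinAt
  have hQc : ContinuousOn (fun t => LinearMap.BilinForm.toMatrix b (γ.vel t))
      (Set.Icc 0 1) := by
    refine continuousOn_pi.2 fun i => continuousOn_pi.2 fun j => ?_
    simp only [LinearMap.BilinForm.toMatrix_apply]
    exact γ.velCont _ _
  have hinv : ContinuousOn (fun t => (LinearMap.BilinForm.toMatrix b (γ.pt t).form)⁻¹)
      (Set.Icc 0 1) := fun t ht => by
    have hdet := (LinearMap.BilinForm.nondegenerate_iff_det_ne_zero b).1 (γ.pt t).nondegenerate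
    have h1 := continuousAt_matrix_inv (LinearMap.BilinForm.toMatrix b (γ.pt t).form)
      (by simpa using continuousAt_inv₀ hdet)
    exact ContinuousAt.comp_continuousWithinAt
      (f := fun t => LinearMap.BilinForm.toMatrix b (γ.pt t).form) h1 (hPc t ht)
  have hHc : ContinuousOn (fun t => LinearMap.toMatrix b b ((γ.pt t).relEnd (γ.vel t)))
      (Set.Icc 0 1) := by
    simp only [hH]
    have hm : ContinuousOn (fun t => LinearMap.BilinForm.toMatrix b (γ.vel t) *
        (LinearMap.BilinForm.toMatrix b (γ.pt t).form)⁻¹) (Set.Icc 0 1) := hQc.mul hinv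
    exact continuous_id.matrix_transpose.comp_continuousOn hm
  have htr : ∀ {f : ℝ → Matrix (Fin (finrank ℝ V)) (Fin (finrank ℝ V)) ℝ},
      ContinuousOn f (Set.Icc 0 1) → ContinuousOn (fun t => (f t).trace) (Set.Icc 0 1) :=
    fun hf => continuous_id.matrix_trace.comp_continuousOn hf
  simp only [InnerForm.speed, LinearMap.trace_eq_matrix_trace ℝ b, LinearMap.toMatrix_comp b b b]
  exact continuousOn_const.mul
    (Real.continuous_sqrt.comp_continuousOn
      ((htr (hHc.mul hHc)).sub (((htr hHc).pow 2).div_const _)))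

/-- The end points of a path of length `L` are comparable with constant `exp (4 L)`. -/
theorem InnerPath.comparable (γ : InnerPath V) :
    Comparable (Real.exp (4 * γ.length)) (γ.pt 0) (γ.pt 1) := fun u v => by
  rcases eq_or_ne u 0 with rfl | hu
  · simp
  rcases eq_or_ne v 0 with rfl | hv
  · simp
  have hlog : ∀ w : V, w ≠ 0 → ∀ t ∈ Set.Icc (0 : ℝ) 1,
      HasDerivWithinAt (fun s => Real.log ((γ.pt s).form w w))
        (γ.vel t w w / (γ.pt t).form w w) (Set.Icc 0 1) t := fun w hw t ht =>
    (γ.hasDeriv t ht w w).log ((γ.pt t).pos w hw).ne'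
  -- Taking the difference for `v` and `u` cancels the trace term, so scaling along the path plays
  -- no role; each Rayleigh quotient contributes `2 * speed`.
  have key := intervalIntegral.sub_le_integral_of_hasDeriv_right_of_le (a := 0) (b := 1)
    (g := fun s => Real.log ((γ.pt s).form v v) - Real.log ((γ.pt s).form u u))
    (g' := fun t => γ.vel t v v / (γ.pt t).form v v - γ.vel t u u / (γ.pt t).form u u)
    (φ := fun t => 4 * (γ.pt t).speed (γ.vel t)) zero_le_one
    (fun t ht => ((hlog v hv t ht).sub (hlog u hu t ht)).continuousWithinAt)
    (fun t ht => by
      have h := (hlog v hv t ⟨ht.1.le, ht.2.le⟩).sub (hlog u hu t ⟨ht.1.le, ht.2.le⟩)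
      exact (h.hasDerivAt (Icc_mem_nhds ht.1 ht.2)).hasDerivWithinAt)
    ((continuousOn_const.mul γ.continuousOn_speed).integrableOn_Icc)
    (fun t ht => by
      have hs := γ.vel_symm (t := t) ⟨ht.1.le, ht.2.le⟩
      have h1 := abs_le.1 ((γ.pt t).abs_sub_trace_le_speed hs hv)
      have h2 := abs_le.1 ((γ.pt t).abs_sub_trace_le_speed hs hu)
      linarith [h1.2, h2.1])
  rw [intervalIntegral.integral_const_mul] at key
  change _ ≤ 4 * γ.length at key
  have p0 := (γ.pt 0).pos
  have p1 := (γ.pt 1).pos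
  rw [← Real.log_le_log_iff (mul_pos (p1 v hv) (p0 u hu))
    (mul_pos (Real.exp_pos _) (mul_pos (p0 v hv) (p1 u hu))),
    Real.log_mul (p1 v hv).ne' (p0 u hu).ne', Real.log_mul (Real.exp_pos _).ne'
      (mul_pos (p0 v hv) (p1 u hu)).ne', Real.log_mul (p0 v hv).ne' (p1 u hu).ne', Real.log_exp]
  linarith

theorem comparable_of_dX_lt {p q : InnerForm V} {L : ℝ} (h : dX (XSpace.mk p) (XSpace.mk q) < L) :
    Comparable (Real.exp (4 * L)) p q := by
  -- Without a joining path, `sInf` would take its default value `0` and carry no information.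
  have hne : {l | ∃ γ : InnerPath V, XSpace.mk (γ.pt 0) = XSpace.mk p ∧
      XSpace.mk (γ.pt 1) = XSpace.mk q ∧ l = γ.length}.Nonempty := by
    obtain ⟨γ, h0, h1⟩ := exists_innerPath p q
    exact ⟨_, γ, by rw [h0], by rw [h1], rfl⟩
  obtain ⟨_, ⟨γ, h0, h1, rfl⟩, hL⟩ := exists_lt_of_csInf_lt hne h
  have := Real.exp_le_exp.2 (mul_le_mul_of_nonneg_left hL.le (zero_le_four (α := ℝ)))
  exact (γ.comparable.mono this).congr h0 h1

end Comparison

/-! ### Diagonal coordinates on flats and min-max for relative eigenvalues -/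

section Diagonal

variable {V : Type*} [NormedAddCommGroup V] [InnerProductSpace ℝ V]

/-- All points of a maximal flat are diagonal in a common basis. -/
theorem IsMaximalFlat.exists_basis {F : Set (XSpace V)} (hF : IsMaximalFlat F) :
    ∃ b : Basis (Fin (finrank ℝ V)) ℝ V, ∀ x ∈ F, ∃ (f : InnerForm V) (z : Fin (finrank ℝ V) → ℝ),
      XSpace.mk f = x ∧ ∀ i j, f.form (b i) (b j) = if i = j then Real.exp (-2 * z i) else 0 := by
  obtain ⟨A, p, -, ⟨b, hA, q, rfl, hq⟩, rfl⟩ := hF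
  refine ⟨b, ?_⟩
  rintro _ ⟨⟨a, ha⟩, rfl⟩
  obtain ⟨g, rfl, hg⟩ := hA a ha
  choose c hc using hg
  have hinv : ∀ i, b i = c i • ((g⁻¹ : GLin V) : V →L[ℝ] V) (b i) := fun i => by
    rw [← map_smul, ← hc, GLin.inv_apply_apply]
  have hc0 : ∀ i, c i ≠ 0 := fun i h => b.ne_zero i (by rw [hinv i, h, zero_smul])
  have hinv' : ∀ i, ((g⁻¹ : GLin V) : V →L[ℝ] V) (b i) = (c i)⁻¹ • b i := fun i => by
    rw [eq_inv_smul_iff₀ (hc0 i), ← hinv]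
  -- The eigenvalues may be negative, but only their inverse squares enter the form.
  refine ⟨g • q, fun i => Real.log |c i|, rfl, fun i j => ?_⟩
  rw [InnerForm.smul_form, hinv', hinv']
  simp only [map_smul, LinearMap.smul_apply, smul_eq_mul, hq]
  split_ifs with h
  · subst h
    rw [show -2 * Real.log |c i| = -(Real.log |c i| + Real.log |c i|) by ring, Real.exp_neg,
      Real.exp_add, Real.exp_log (abs_pos.2 (hc0 i)), abs_mul_abs_self, mul_one, mul_inv]
  · simp

/-- For two bases, some non-zero vector is spanned by the first `k + 1` vectors of the one and by
the vectors of the other from the `k`-th one on. -/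
theorem exists_ne_zero_repr_eq_zero {n : ℕ} (e b : Basis (Fin n) ℝ V) (k : Fin n) :
    ∃ v : V, v ≠ 0 ∧ (∀ i < k, e.repr v i = 0) ∧ ∀ i, k < i → b.repr v i = 0 := by
  have : FiniteDimensional ℝ V := e.finiteDimensional_of_finite
  -- The index `k` is free in both bases, which leaves only `n - 1` linear conditions.
  let T : V →ₗ[ℝ] ({i : Fin n // i ≠ k} → ℝ) :=
    LinearMap.pi fun i => if i.1 < k then e.coord i else b.coord i
  have hrank : finrank ℝ ({i : Fin n // i ≠ k} → ℝ) < finrank ℝ V := by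
    rw [finrank_fintype_fun_eq_card, finrank_eq_card_basis e]
    exact Fintype.card_subtype_lt (x := k) (by simp)
  obtain ⟨v, hv, hv0⟩ := (Submodule.ne_bot_iff _).1 (T.ker_ne_bot_of_finrank_lt hrank)
  have hT : ∀ i : {i : Fin n // i ≠ k}, T v i = 0 := fun i => congrFun (LinearMap.mem_ker.1 hv) i
  refine ⟨v, hv0, fun i hi => ?_, fun i hi => ?_⟩
  · simpa [T, hi] using hT ⟨i, hi.ne⟩
  · simpa [T, hi.not_gt] using hT ⟨i, hi.ne'⟩

/-- Monotonicity of the relative eigenvalues of pairs of inner products. -/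
theorem relative_eigenvalue_le {n : ℕ} {e b : Basis (Fin n) ℝ V} {p q p' q' : InnerForm V}
    {a l a' l' : Fin n → ℝ}
    (hp : ∀ i j, p.form (e i) (e j) = if i = j then a i else 0)
    (hq : ∀ i j, q.form (e i) (e j) = if i = j then l i * a i else 0)
    (hp' : ∀ i j, p'.form (b i) (b j) = if i = j then a' i else 0)
    (hq' : ∀ i j, q'.form (b i) (b j) = if i = j then l' i * a' i else 0)
    (hl : Antitone l) (hl' : Antitone l') {M : ℝ} (hM : 0 ≤ M)
    (h : ∀ v, q'.form v v * p.form v v ≤ M * (q.form v v * p'.form v v)) (k : Fin n) :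
    l' k ≤ M * l k := by
  obtain ⟨v, hv, hve, hvb⟩ := exists_ne_zero_repr_eq_zero e b k
  have ha : ∀ i, 0 ≤ a i := fun i => by simpa [hp] using p.nonneg (e i)
  have ha' : ∀ i, 0 ≤ a' i := fun i => by simpa [hp'] using p'.nonneg (b i)
  have h1 : q.form v v ≤ l k * p.form v v := by
    rw [form_self_eq_sum_of_diagonal hp, form_self_eq_sum_of_diagonal hq, Finset.mul_sum]
    refine Finset.sum_le_sum fun i _ => ?_
    rcases lt_or_ge i k with hi | hi
    · simp [hve i hi]
    · rw [mul_assoc]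
      exact mul_le_mul_of_nonneg_right (hl hi) (mul_nonneg (ha i) (sq_nonneg _))
  have h2 : l' k * p'.form v v ≤ q'.form v v := by
    rw [form_self_eq_sum_of_diagonal hp', form_self_eq_sum_of_diagonal hq', Finset.mul_sum]
    refine Finset.sum_le_sum fun i _ => ?_
    rcases lt_or_ge k i with hi | hi
    · simp [hvb i hi]
    · rw [mul_assoc (l' i)]
      exact mul_le_mul_of_nonneg_right (hl' hi) (mul_nonneg (ha' i) (sq_nonneg _))
  have hpos := mul_pos (p.pos v hv) (p'.pos v hv)
  refine le_of_mul_le_mul_right ?_ hpos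
  calc l' k * (p.form v v * p'.form v v) = l' k * p'.form v v * p.form v v := by ring
    _ ≤ q'.form v v * p.form v v := mul_le_mul_of_nonneg_right h2 (p.nonneg _)
    _ ≤ M * (q.form v v * p'.form v v) := h v
    _ ≤ M * (l k * p.form v v * p'.form v v) :=
        mul_le_mul_of_nonneg_left (mul_le_mul_of_nonneg_right h1 (p'.nonneg _)) hM
    _ = _ := by ring

/-- Ratios of relative eigenvalues are stable under comparability. -/
theorem relative_eigenvalue_ratio_le {n : ℕ} {e b : Basis (Fin n) ℝ V} {p q p' q' : InnerForm V}
    {a l a' l' : Fin n → ℝ}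
    (hp : ∀ i j, p.form (e i) (e j) = if i = j then a i else 0)
    (hq : ∀ i j, q.form (e i) (e j) = if i = j then l i * a i else 0)
    (hp' : ∀ i j, p'.form (b i) (b j) = if i = j then a' i else 0)
    (hq' : ∀ i j, q'.form (b i) (b j) = if i = j then l' i * a' i else 0)
    (hl : Antitone l) (hl' : Antitone l') (hl0 : ∀ i, 0 ≤ l i) {K : ℝ} (hK : 0 ≤ K)
    (hpp : Comparable K p p') (hqq : Comparable K q q') (i j : Fin n) :
    l' i * l j ≤ K ^ 4 * (l i * l' j) := by
  have hw := e.ne_zero i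
  have pw := p.pos _ hw
  have qw := q.pos _ hw
  have pw' := p'.pos _ hw
  have qw' := q'.pos _ hw
  set w := e i
  -- Comparability fixes forms only up to scale, so everything is normalized at the reference vector
  -- `w`. The scale factors in `h1` and `h2` are inverse to each other and cancel in the product,
  -- leaving `K ^ 4`.
  have h1 : l' i ≤ K ^ 2 * (q'.form w w * p.form w w / (q.form w w * p'.form w w)) * l i := by
    refine relative_eigenvalue_le hp hq hp' hq' hl hl' (by positivity) (fun v => ?_) i
    have h3 := mul_le_mul (hqq w v) (hpp.symm w v)
      (mul_nonneg (p.nonneg _) (p'.nonneg _))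
      (mul_nonneg hK (mul_nonneg (q.nonneg _) (q'.nonneg _)))
    rw [← sub_nonneg] at h3 ⊢
    have : K ^ 2 * (q'.form w w * p.form w w / (q.form w w * p'.form w w)) *
        (q.form v v * p'.form v v) - q'.form v v * p.form v v =
        (K * (q.form v v * q'.form w w) * (K * (p'.form v v * p.form w w))
          - q'.form v v * q.form w w * (p.form v v * p'.form w w)) /
          (q.form w w * p'.form w w) := by
      field_simp
    rw [this]
    exact div_nonneg h3 (mul_pos qw pw').le
  have h2 : l j ≤ K ^ 2 * (q.form w w * p'.form w w / (q'.form w w * p.form w w)) * l' j := by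
    refine relative_eigenvalue_le hp' hq' hp hq hl' hl (by positivity) (fun v => ?_) j
    have h3 := mul_le_mul (hqq.symm w v) (hpp w v)
      (mul_nonneg (p'.nonneg _) (p.nonneg _))
      (mul_nonneg hK (mul_nonneg (q'.nonneg _) (q.nonneg _)))
    rw [← sub_nonneg] at h3 ⊢
    have : K ^ 2 * (q.form w w * p'.form w w / (q'.form w w * p.form w w)) *
        (q'.form v v * p.form v v) - q.form v v * p'.form v v =
        (K * (q'.form v v * q.form w w) * (K * (p.form v v * p'.form w w))
          - q.form v v * q'.form w w * (p'.form v v * p.form w w)) /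
          (q'.form w w * p.form w w) := by
      field_simp
    rw [this]
    exact div_nonneg h3 (mul_pos qw' pw).le
  refine (mul_le_mul h1 h2 (hl0 j) (mul_nonneg (by positivity) (hl0 i))).trans_eq ?_
  field_simp

end Diagonal

/-! ### Singular values as relative eigenvalues of translated inner products -/

section SingularValues

variable {V : Type*} [NormedAddCommGroup V] [InnerProductSpace ℝ V]

variable (V) in
/-- The inner product that `V` carries. -/
def baseForm : InnerForm V where
  form := innerₗ V
  symm := fun u v => by simp [real_inner_comm]
  pos := fun v hv => by simpa using real_inner_self_pos.2 hv

theorem mk_smul_baseForm (g : GLin V) :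
    XSpace.mk (g • baseForm V) = (g : PGLin V) • basePoint V := rfl

variable [FiniteDimensional ℝ V]

/-- The squares of the singular values of `g⁻¹ h` are the relative eigenvalues of the translates
of the standard inner product by `g` and `h`. -/
theorem exists_basis_singularValues (g h : GLin V) :
    ∃ e : Basis (Fin (finrank ℝ V)) ℝ V,
      (∀ i j, (h • baseForm V).form (e i) (e j) = if i = j then 1 else 0) ∧
      ∀ i j, (g • baseForm V).form (e i) (e j) =
        if i = j then
          ((g⁻¹ * h : GLin V) : V →L[ℝ] V).toLinearMap.singularValues i ^ 2 * 1 else 0 := by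
  set T := ((g⁻¹ * h : GLin V) : V →L[ℝ] V).toLinearMap with hT
  have hsymm := T.isSymmetric_adjoint_comp_self
  -- The wanted basis is the image under `h` of an orthonormal eigenbasis of the adjoint of `T`
  -- composed with `T`.
  set u := hsymm.eigenvectorBasis rfl with hu
  refine ⟨u.toBasis.map (ContinuousLinearEquiv.unitsEquiv ℝ V h).toLinearEquiv,
    fun i j => ?_, fun i j => ?_⟩
  · have h1 := orthonormal_iff_ite.1 u.orthonormal i j
    change inner ℝ (((h⁻¹ : GLin V) : V →L[ℝ] V) ((h : V →L[ℝ] V) (u.toBasis i)))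
      (((h⁻¹ : GLin V) : V →L[ℝ] V) ((h : V →L[ℝ] V) (u.toBasis j))) = _
    rw [GLin.inv_apply_apply, GLin.inv_apply_apply]
    simpa using h1
  · have h1 := orthonormal_iff_ite.1 u.orthonormal i j
    change inner ℝ (((g⁻¹ : GLin V) : V →L[ℝ] V) ((h : V →L[ℝ] V) (u.toBasis i)))
      (((g⁻¹ : GLin V) : V →L[ℝ] V) ((h : V →L[ℝ] V) (u.toBasis j))) = _
    have h2 : ∀ k, ((g⁻¹ : GLin V) : V →L[ℝ] V) ((h : V →L[ℝ] V) (u.toBasis k)) = T (u k) :=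
      fun k => by simp [hT]
    rw [h2, h2, ← LinearMap.adjoint_inner_left, ← LinearMap.comp_apply, hu,
      hsymm.apply_eigenvectorBasis rfl i, ← hu, inner_smul_left, h1,
      T.sq_singularValues_fin rfl i]
    split_ifs <;> simp

theorem singularValues_unit_pos (g : GLin V) (i : Fin (finrank ℝ V)) :
    0 < (g : V →L[ℝ] V).toLinearMap.singularValues i := by
  refine (LinearMap.injective_iff_forall_lt_finrank_singularValues_pos _).1 ?_ i i.2
  exact Function.LeftInverse.injective (g := ((g⁻¹ : GLin V) : V →L[ℝ] V))
    (GLin.inv_apply_apply g)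

theorem cartanGL_antitone (g : GLin V) : Antitone (cartanGL g) := fun _ _ h =>
  Real.log_le_log (singularValues_unit_pos g _) (LinearMap.singularValues_antitone _ h)

/-- The gaps of the Cartan projection of `g⁻¹ h` are up to a bounded error those of the sorted
difference of the diagonal coordinates of nearby points of a flat. -/
theorem abs_cartanGL_gap_sub_le {g h : GLin V} {b : Basis (Fin (finrank ℝ V)) ℝ V}
    {f f' : InnerForm V} {x y : Fin (finrank ℝ V) → ℝ}
    (hf : ∀ i j, f.form (b i) (b j) = if i = j then Real.exp (-2 * x i) else 0)
    (hf' : ∀ i j, f'.form (b i) (b j) = if i = j then Real.exp (-2 * y i) else 0)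
    {K : ℝ} (hK : 0 < K) (hg : Comparable K (g • baseForm V) f)
    (hh : Comparable K (h • baseForm V) f') {τ : Equiv.Perm (Fin (finrank ℝ V))}
    (hτ : Antitone fun i => y (τ i) - x (τ i)) (k l : Fin (finrank ℝ V)) :
    |cartanGL (g⁻¹ * h) k - cartanGL (g⁻¹ * h) l
      - ((y (τ k) - x (τ k)) - (y (τ l) - x (τ l)))| ≤ 2 * Real.log K := by
  obtain ⟨e, he1, he2⟩ := exists_basis_singularValues g h
  set s : Fin (finrank ℝ V) → ℝ := fun i =>
    ((g⁻¹ * h : GLin V) : V →L[ℝ] V).toLinearMap.singularValues i with hs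
  have spos : ∀ i, 0 < s i := singularValues_unit_pos (g⁻¹ * h)
  have hl : Antitone fun i => s i ^ 2 := fun i j hij =>
    pow_le_pow_left₀ (spos j).le (LinearMap.singularValues_antitone _ hij) 2
  have hl' : Antitone fun i => Real.exp (2 * (y (τ i) - x (τ i))) := fun i j hij =>
    Real.exp_le_exp.2 (mul_le_mul_of_nonneg_left (hτ hij) zero_le_two)
  have key : ∀ i j, (y (τ i) - x (τ i)) - (y (τ j) - x (τ j)) ≤
      2 * Real.log K + (Real.log (s i) - Real.log (s j)) := fun i j => by
    -- Reindexing makes the relative eigenvalues `exp (2 * (y - x))` of `f` with respect to `f'`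
    -- antitone. Taking logarithms of squares turns `K ^ 4` into `2 * log K`.
    have h1 := relative_eigenvalue_ratio_le (e := e) (b := b.reindex τ.symm)
      (a' := fun i => Real.exp (-2 * y (τ i))) he1 he2
      (fun i j => by simp [hf']) (fun i j => by simp [hf, ← Real.exp_add]; ring_nf)
      hl hl' (fun i => sq_nonneg _) hK.le hh hg i j
    have h2 := Real.log_le_log (mul_pos (Real.exp_pos _) (pow_pos (spos j) 2)) h1
    rw [Real.log_mul (Real.exp_pos _).ne' (pow_pos (spos j) 2).ne', Real.log_mul
      (pow_pos hK 4).ne' (mul_pos (pow_pos (spos i) 2) (Real.exp_pos _)).ne', Real.log_mul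
      (pow_pos (spos i) 2).ne' (Real.exp_pos _).ne', Real.log_exp, Real.log_exp, Real.log_pow,
      Real.log_pow, Real.log_pow] at h2
    push_cast at h2
    linarith
  have h1 := key k l
  have h2 := key l k
  change |Real.log (s k) - Real.log (s l) - _| ≤ _
  rw [abs_le]
  constructor <;> linarith

/-- A crude bound for the early times, where regulation gives no information; it comes from testing
comparability on two vectors of the singular basis. -/
theorem cartanGL_gap_le {g h : GLin V} {K : ℝ} (hK : 0 < K)
    (hgh : Comparable K (h • baseForm V) (g • baseForm V)) (k l : Fin (finrank ℝ V)) :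
    cartanGL (g⁻¹ * h) k - cartanGL (g⁻¹ * h) l ≤ Real.log K / 2 := by
  obtain ⟨e, he1, he2⟩ := exists_basis_singularValues g h
  have sk := singularValues_unit_pos (g⁻¹ * h) k
  have sl := singularValues_unit_pos (g⁻¹ * h) l
  have h1 := hgh (e l) (e k)
  simp only [he1, he2, if_true, mul_one, one_mul] at h1
  have h2 := Real.log_le_log (pow_pos sk 2) h1
  rw [Real.log_mul hK.ne' (pow_pos sl 2).ne', Real.log_pow, Real.log_pow] at h2
  rw [Nat.cast_ofNat] at h2
  change Real.log _ - Real.log _ ≤ _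
  linarith

end SingularValues

/-! ### Real sequences with bounded steps -/

section Growth

theorem abs_sub_le_of_steps {s : ℕ → ℝ} {C : ℝ} (hs : ∀ i, |s (i + 1) - s i| ≤ C) (i j : ℕ) :
    |s (i + j) - s i| ≤ C * j := by
  induction j with
  | zero => simp
  | succ j ih =>
    have h1 := hs (i + j)
    rw [abs_le] at *
    rw [← add_assoc]
    push_cast
    constructor <;> linarith [h1.1, h1.2, ih.1, ih.2]

/-- A real sequence with small steps whose increments are eventually large has increments of
constant sign. -/
theorem le_sub_of_le_abs_sub {s : ℕ → ℝ} {C D : ℝ} {N : ℕ} (hs : ∀ i, |s (i + 1) - s i| ≤ C)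
    (hCD : 2 * C < D) (hD : ∀ i j, N ≤ j → D ≤ |s (i + j) - s i|) (h0 : 0 ≤ s N - s 0)
    (i j : ℕ) (hj : N ≤ j) : D ≤ s (i + j) - s i := by
  have hC : 0 ≤ C := (abs_nonneg _).trans (hs 0)
  have up : ∀ i j, N ≤ j → 0 ≤ s (i + j) - s i → D ≤ s (i + j) - s i := fun i j hj h =>
    (hD i j hj).trans_eq (abs_of_nonneg h)
  induction j, hj using Nat.le_induction with
  | base =>
    -- Shifting the window by one changes the increment by at most `2 * C < D`, so it remains
    -- nonnegative and hence at least `D`.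
    induction i with
    | zero => exact up 0 N le_rfl (by simpa using h0)
    | succ i ih =>
      refine up _ _ le_rfl ?_
      have h1 := abs_le.1 (hs i)
      have h2 := abs_le.1 (hs (i + N))
      rw [add_right_comm]
      linarith [h1.2, h2.1]
  | succ j hj ih =>
    refine up _ _ (hj.trans j.le_succ) ?_
    have h2 := abs_le.1 (hs (i + j))
    rw [← add_assoc]
    linarith [h2.1]

theorem linear_growth {s : ℕ → ℝ} {C D : ℝ} {N : ℕ} (hN : 0 < N) (hD0 : 0 ≤ D)
    (hs : ∀ i, |s (i + 1) - s i| ≤ C) (hD : ∀ i, D ≤ s (i + N) - s i) (i j : ℕ) :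
    D / N * j - (D + C * N) ≤ s (i + j) - s i := by
  have hC : 0 ≤ C := (abs_nonneg _).trans (hs 0)
  have hN' : (0 : ℝ) < N := by exact_mod_cast hN
  -- Blocks of length `N` are removed one at a time; the incomplete last block costs at most `D + C
  -- * N`.
  induction j using Nat.strong_induction_on generalizing i with
  | _ j ih =>
    rcases lt_or_ge j N with hj | hj
    · have hj' : (j : ℝ) ≤ N := by exact_mod_cast hj.le
      have h1 := (abs_le.1 (abs_sub_le_of_steps hs i j)).1
      have h2 := mul_le_mul_of_nonneg_left hj' hC
      have h3 := mul_le_mul_of_nonneg_left hj' (div_nonneg hD0 hN'.le)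
      rw [div_mul_cancel₀ _ hN'.ne'] at h3
      linarith
    · have h1 := ih (j - N) (by omega) (i + N)
      have h2 := hD i
      rw [show i + N + (j - N) = i + j by omega, Nat.cast_sub hj, mul_sub,
        div_mul_cancel₀ _ hN'.ne'] at h1
      linarith

theorem exists_perm_antitone {n : ℕ} (z : Fin n → ℝ) :
    ∃ τ : Equiv.Perm (Fin n), Antitone fun i => z (τ i) :=
  ⟨Tuple.sort fun i => -z i, fun _ _ h =>
    neg_le_neg_iff.1 (Tuple.monotone_sort (fun i => -z i) h)⟩

end Growth

/-! ### Sequences close to a flat -/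

section Sequences

variable {V : Type*} [NormedAddCommGroup V] [InnerProductSpace ℝ V]

theorem Comparable.pow_of_steps {p : ℕ → InnerForm V} {K : ℝ} (hK : 0 ≤ K)
    (hp : ∀ i, Comparable K (p i) (p (i + 1))) (m : ℕ) : Comparable (K ^ m) (p 0) (p m) := by
  induction m with
  | zero => exact fun u v => by simp [mul_comm]
  | succ m ih =>
    rw [pow_succ]
    exact ih.trans (pow_nonneg hK m) (hp m)

/-- Comparable inner products that are diagonal in the same basis have nearby coordinates. -/
theorem Comparable.abs_root_sub_le {b : Basis (Fin (finrank ℝ V)) ℝ V} {f f' : InnerForm V}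
    {x y : Fin (finrank ℝ V) → ℝ} {K : ℝ} (hK : 0 < K) (h : Comparable K f f')
    (hf : ∀ i j, f.form (b i) (b j) = if i = j then Real.exp (-2 * x i) else 0)
    (hf' : ∀ i j, f'.form (b i) (b j) = if i = j then Real.exp (-2 * y i) else 0)
    (k l : Fin (finrank ℝ V)) : |(y k - y l) - (x k - x l)| ≤ Real.log K / 2 := by
  have key : ∀ k l, 2 * ((x k - x l) - (y k - y l)) ≤ Real.log K := fun k l => by
    have h1 := h (b l) (b k)
    simp only [hf, hf', if_true, ← Real.exp_add] at h1
    have h2 := Real.log_le_log (Real.exp_pos _) h1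
    rw [Real.log_mul hK.ne' (Real.exp_pos _).ne', Real.log_exp, Real.log_exp] at h2
    linarith
  have h1 := key k l
  have h2 := key l k
  rw [abs_le]
  constructor <;> linarith

theorem IsMaximalFlat.nonempty {F : Set (XSpace V)} (hF : IsMaximalFlat F) : F.Nonempty := by
  obtain ⟨A, p, -, -, rfl⟩ := hF
  exact MulAction.nonempty_orbit p

variable [FiniteDimensional ℝ V]

theorem cartan_inv_mul {g h : GLin V} (hg : |LinearMap.det (g : V →L[ℝ] V).toLinearMap| = 1)
    (hh : |LinearMap.det (h : V →L[ℝ] V).toLinearMap| = 1) :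
    cartan ((g : PGLin V)⁻¹ * (h : PGLin V)) = cartanGL (g⁻¹ * h) := by
  refine cartan_mk (g⁻¹ * h) ?_
  have h1 : ((g : V →L[ℝ] V).toLinearMap) ∘ₗ ((g⁻¹ * h : GLin V) : V →L[ℝ] V).toLinearMap =
      (h : V →L[ℝ] V).toLinearMap := LinearMap.ext fun v => by
    have : g * (g⁻¹ * h) = h := by group
    exact congrArg (fun k : GLin V => (k : V →L[ℝ] V) v) this
  rw [← h1, LinearMap.det_comp, abs_mul, hg, one_mul] at hh
  exact hh

/-- A sequence of unimodular matrices starting at the identity whose orbit stays close to a flat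
and whose increments have eventually large Cartan gaps has linearly growing Cartan gaps. -/
theorem linear_growth_cartanGL {g : ℕ → GLin V} {b : Basis (Fin (finrank ℝ V)) ℝ V}
    {f : ℕ → InnerForm V} {y : ℕ → Fin (finrank ℝ V) → ℝ} {L : ℝ} {N : ℕ} (hL : 0 < L)
    (hN : 0 < N)
    (hf : ∀ m i j, (f m).form (b i) (b j) = if i = j then Real.exp (-2 * y m i) else 0)
    (hgf : ∀ m, Comparable (Real.exp L) (g m • baseForm V) (f m))
    (hgg : ∀ m, Comparable (Real.exp L) (g m • baseForm V) (g (m + 1) • baseForm V))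
    (hreg : ∀ i j, N ≤ j → ∀ (k : ℕ) (hk : k + 1 < finrank ℝ V),
      6 * L ≤ cartanGL ((g i)⁻¹ * g (i + j)) ⟨k, by omega⟩
        - cartanGL ((g i)⁻¹ * g (i + j)) ⟨k + 1, hk⟩)
    (i j k : ℕ) (hk : k + 1 < finrank ℝ V) :
    4 * L / N * j - (8 * L + 7 * L * N) ≤
      (cartanGL ((g 0)⁻¹ * g (i + j)) ⟨k, by omega⟩
        - cartanGL ((g 0)⁻¹ * g (i + j)) ⟨k + 1, hk⟩)
      - (cartanGL ((g 0)⁻¹ * g i) ⟨k, by omega⟩ - cartanGL ((g 0)⁻¹ * g i) ⟨k + 1, hk⟩) := by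
  -- Three comparisons, from `f m` through `g m` and `g (m + 1)` to `f (m + 1)`, give the constant
  -- `exp (3 * L)`, whose logarithm is halved.
  have hstep : ∀ k l m, |(y (m + 1) k - y (m + 1) l) - (y m k - y m l)| ≤ 3 / 2 * L :=
    fun k l m => by
      have h1 := ((hgf m).symm.trans (Real.exp_pos L).le (hgg m)).trans (by positivity) (hgf (m + 1))
      refine (h1.abs_root_sub_le (by positivity) (hf m) (hf (m + 1)) k l).trans_eq ?_
      rw [← Real.exp_add, ← Real.exp_add, Real.log_exp]
      ring
  have hgap : ∀ (i m : ℕ) (τ : Equiv.Perm (Fin (finrank ℝ V))),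
      (Antitone fun k => y m (τ k) - y i (τ k)) → ∀ k l,
      |cartanGL ((g i)⁻¹ * g m) k - cartanGL ((g i)⁻¹ * g m) l
        - ((y m (τ k) - y i (τ k)) - (y m (τ l) - y i (τ l)))| ≤ 2 * L := fun i m τ hτ k l => by
    have h1 := abs_cartanGL_gap_sub_le (hf i) (hf m) (Real.exp_pos L) (hgf i) (hgf m) hτ k l
    rwa [Real.log_exp] at h1
  -- `6 * L` from regulation minus the `2 * L` error. The sorting permutation may still depend on
  -- `i` and `j`, hence the absolute value.
  have hlarge : ∀ a c, a ≠ c → ∀ i j, N ≤ j →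
      4 * L ≤ |(y (i + j) a - y (i + j) c) - (y i a - y i c)| := by
    intro a c hac i j hj
    obtain ⟨τ, hτ⟩ := exists_perm_antitone fun k => y (i + j) k - y i k
    have hlt : ∀ k l : Fin (finrank ℝ V), k < l →
        4 * L ≤ (y (i + j) (τ k) - y i (τ k)) - (y (i + j) (τ l) - y i (τ l)) := fun k l hkl => by
      have hk1 : k.1 + 1 < finrank ℝ V := by omega
      have h1 := hreg i j hj k hk1
      have h2 := (abs_le.1 (hgap i (i + j) τ hτ k ⟨k + 1, hk1⟩)).2
      have h3 := hτ (show (⟨k + 1, hk1⟩ : Fin (finrank ℝ V)) ≤ l from hkl)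
      simp only [Fin.eta] at h1
      linarith
    rcases lt_trichotomy (τ.symm a) (τ.symm c) with h | h | h
    · have := hlt _ _ h
      simp only [Equiv.apply_symm_apply] at this
      exact le_trans (by linarith) (le_abs_self _)
    · exact absurd (τ.symm.injective h) hac
    · have := hlt _ _ h
      simp only [Equiv.apply_symm_apply] at this
      exact le_trans (by linarith) (neg_le_abs _)
  -- The order at time `N` is the order for all increments of length at least `N`: roots cannot
  -- change sign, since `2 * (3 / 2 * L) < 4 * L`.
  obtain ⟨τ, hτ⟩ := exists_perm_antitone fun k => y N k - y 0 k
  have hpos : ∀ k l, k < l → ∀ i j, N ≤ j →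
      4 * L ≤ (y (i + j) (τ k) - y (i + j) (τ l)) - (y i (τ k) - y i (τ l)) := fun k l hkl =>
    le_sub_of_le_abs_sub (s := fun m => y m (τ k) - y m (τ l)) (hstep _ _) (by linarith)
      (hlarge _ _ (τ.injective.ne hkl.ne)) (by linarith [hτ hkl.le])
  have hanti : ∀ i j, N ≤ j → Antitone fun k => y (i + j) (τ k) - y i (τ k) := by
    intro i j hj k l hkl
    rcases hkl.eq_or_lt with rfl | h
    · exact le_rfl
    · linarith [hpos k l h i j hj]
  set k0 : Fin (finrank ℝ V) := ⟨k, by omega⟩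
  set k1 : Fin (finrank ℝ V) := ⟨k + 1, hk⟩
  have hk01 : k0 < k1 := Nat.lt_succ_self k
  set s : ℕ → ℝ := fun m => y m (τ k0) - y m (τ k1) with hs
  have hclose : ∀ m, |cartanGL ((g 0)⁻¹ * g m) k0 - cartanGL ((g 0)⁻¹ * g m) k1 - (s m - s 0)|
      ≤ 2 * L + 5 / 2 * L * N := fun m => by
    have hLN : 0 ≤ L * N := by positivity
    -- For `m < N`, `τ` need not sort `y m - y 0`, but the gap and the root increment are both
    -- bounded by multiples of `L * N`.
    rcases lt_or_ge m N with hm | hm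
    · have hm' : (m : ℝ) ≤ N := by exact_mod_cast hm.le
      have hLm := mul_le_mul_of_nonneg_left hm' hL.le
      have h1 := cartanGL_antitone ((g 0)⁻¹ * g m) hk01.le
      have h2 := cartanGL_gap_le (by positivity)
        (Comparable.pow_of_steps (Real.exp_pos L).le hgg m).symm k0 k1
      rw [Real.log_pow, Real.log_exp] at h2
      have h3 := abs_le.1 (abs_sub_le_of_steps (s := s) (hstep _ _) 0 m)
      rw [zero_add] at h3
      rw [abs_le]
      constructor <;> linarith [h3.1, h3.2]
    · have ha := hanti 0 m hm
      simp only [zero_add] at ha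
      have h1 := abs_le.1 (hgap 0 m τ ha k0 k1)
      simp only [hs]
      rw [abs_le]
      constructor <;> linarith [h1.1, h1.2]
  -- The loss here is `4 * L + 3 / 2 * L * N`; two uses of `hclose` add `4 * L + 5 * L * N`, within
  -- the stated `8 * L + 7 * L * N`.
  have hgrow := linear_growth (s := s) hN (by positivity) (hstep _ _)
    (fun i => hpos k0 k1 hk01 i N le_rfl) i j
  have h1 := abs_le.1 (hclose (i + j))
  have h2 := abs_le.1 (hclose i)
  have hLN : 0 ≤ L * N := by positivity
  linarith [h1.1, h2.2]

/-- A point of `X` within distance `C` of a set is within distance less than `C + 1` of one of its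
points. -/
theorem exists_dX_lt_of_dXSet_le {x : XSpace V} {F : Set (XSpace V)} (hF : F.Nonempty) {C : ℝ}
    (h : dXSet x F ≤ C) : ∃ y ∈ F, dX x y < C + 1 := by
  obtain ⟨_, ⟨y, hy, rfl⟩, hlt⟩ := exists_lt_of_csInf_lt (hF.image _) (h.trans_lt (lt_add_one C))
  exact ⟨y, hy, hlt⟩

end Sequences

end SymmSpace

end

theorem mainTheorem6 {V : Type*} [NormedAddCommGroup V] [InnerProductSpace ℝ V]
    [FiniteDimensional ℝ V] (W : Set (ℕ → SymmSpace.PGLin V))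
    (hrooted : ∀ w ∈ W, SymmSpace.IsRooted w)
    (hreg : SymmSpace.Regulated W)
    (hwell : SymmSpace.UniformlyWellBehaved W) :
    ∃ κ κ' : ℝ, 0 < κ ∧ 0 < κ' ∧ ∀ w ∈ W, ∀ i j : ℕ,
      ∀ α ∈ SymmSpace.simpleRoots (Module.finrank ℝ V),
        κ * (j : ℝ) - κ' ≤
          α (SymmSpace.cartan (w (i + j))) - α (SymmSpace.cartan (w i)) := by
  obtain ⟨C, hC, hwell⟩ := hwell
  -- The `+ 1` absorbs the infima in `dX` and `dXSet`, which need not be attained.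
  set L : ℝ := 4 * (C + 1) with hLdef
  have hL : 0 < L := by positivity
  obtain ⟨N, hN, hreg⟩ := hreg (6 * L) (by positivity)
  have hN' : (0 : ℝ) < N := by exact_mod_cast hN
  refine ⟨4 * L / N, 8 * L + 7 * L * N, by positivity, by positivity, ?_⟩
  rintro w hw i j _ ⟨k, hk, rfl⟩
  obtain ⟨⟨F, hF, hdist⟩, hstep⟩ := hwell w hw
  choose g hg hdet using fun m => SymmSpace.exists_unimodular_rep (w m)
  have hcartan : ∀ m l, SymmSpace.cartan ((w m)⁻¹ * w l) =
      SymmSpace.cartanGL ((g m)⁻¹ * g l) := fun m l => by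
    rw [← hg m, ← hg l, SymmSpace.cartan_inv_mul (hdet m) (hdet l)]
  -- The chosen representative `g 0` of the identity class need not be the identity, so it is kept
  -- in the formula.
  have hcartan0 : ∀ m, SymmSpace.cartan (w m) = SymmSpace.cartanGL ((g 0)⁻¹ * g m) := fun m => by
    rw [← hcartan, show w 0 = 1 from hrooted w hw, inv_one, one_mul]
  obtain ⟨b, hb⟩ := hF.exists_basis
  choose x hxF hx using fun m => SymmSpace.exists_dX_lt_of_dXSet_le hF.nonempty (hdist m)
  choose f y hfx hf using fun m => hb (x m) (hxF m)
  rw [hcartan0, hcartan0]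
  refine SymmSpace.linear_growth_cartanGL hL hN hf (fun m => ?_) (fun m => ?_)
    (fun i j hj k hk => ?_) i j k hk
  · refine SymmSpace.comparable_of_dX_lt ?_
    rw [SymmSpace.mk_smul_baseForm, hg, hfx]
    exact hx m
  · refine SymmSpace.comparable_of_dX_lt ?_
    rw [SymmSpace.mk_smul_baseForm, SymmSpace.mk_smul_baseForm, hg, hg]
    exact (hstep m).trans_lt (lt_add_one C)
  · rw [← hcartan]
    exact hreg w hw i j hj _ ⟨k, hk, rfl⟩
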